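/- Let $R$ be a commutative Bezout domain, i.e. a commutative integral domain in which every finitely generated ideal is principal. The following two conditions are equivalent. (i) $R$ has stable range $1.5$: for all $a,b\in R$ and all $0\neq c\in R$ with $aR+bR+cR=R$ there exists $r\in R$ such that $(a+br)R+cR=R$. (ii) For all positive integers $n,m$ and every matrix $A\in R^{n\times m}$ with $\operatorname{rank}(A)>1$ there is a row $u=[1,u_2,\ldots,u_n]\in R^{1\times n}$ such that, writing $uA=[b_1,\ldots,b_m]$, the greatest common divisor of $b_1,\ldots,b_m$ coincides (up to a unit factor) with the greatest common divisor of all the entries of $A$. -/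

import Mathlib

/-- A commutative ring has stable range 1.5 if, whenever `aR + bR + cR = R` with `c ≠ 0`,
there is `r` such that `(a + br)R + cR = R`. -/
def HasStableRangeOneAndHalf (R : Type*) [CommRing R] : Prop :=
  ∀ a b c : R, c ≠ 0 → Ideal.span {a, b, c} = ⊤ → ∃ r : R, Ideal.span {a + b * r, c} = ⊤

/-- `d` is a greatest common divisor of the family `f`: it divides all the members of the family,
and it is divisible by each of their common divisors. -/
def IsGCDOfFamily {R ι : Type*} [CommRing R] (f : ι → R) (d : R) : Prop :=
  (∀ i, d ∣ f i) ∧ ∀ e : R, (∀ i, e ∣ f i) → e ∣ d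

/-! For (i) ⇒ (ii), the core is two non-proportional rows `x`, `y` (`exists_add_smul_dvd`). Write `y
= β y'` with `t ⬝ y' = 1`, and set `α = t ⬝ x`, `γ = gcd (x - α y') ≠ 0`. A common divisor of `x + r
y` divides `α + β r`, hence also `γ`; stable range 1.5 gives `r` for which it divides `α` and `β`,
hence `x` and `y`. Rows are then absorbed one at a time (`exists_vecMul_dvd`), a companion `w`
keeping `uA` and `wA` non-proportional. For (ii) ⇒ (i), a 2 × 2 matrix suffices. -/

theorem exists_dvd_and_eq_sum {R ι : Type*} [CommRing R] [IsBezout R] [Fintype ι] (f : ι → R) :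
    ∃ (g : R) (t : ι → R), (∀ i, g ∣ f i) ∧ g = ∑ i, t i * f i := by
  have hfg : (Ideal.span (Set.range f)).FG := Submodule.fg_span (Set.finite_range f)
  obtain ⟨g, hg⟩ := (IsBezout.isPrincipal_of_FG _ hfg).principal
  have hmem : g ∈ Ideal.span (Set.range f) := hg ▸ Ideal.mem_span_singleton_self g
  obtain ⟨t, ht⟩ := Ideal.mem_span_range_iff_exists_fun.1 hmem
  refine ⟨g, t, fun i => ?_, ht.symm⟩
  have hi : f i ∈ Ideal.span (Set.range f) := Ideal.subset_span ⟨i, rfl⟩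
  rw [hg] at hi
  exact Ideal.mem_span_singleton.1 hi

theorem exists_isGCDOfFamily {R ι : Type*} [CommRing R] [IsBezout R] [Fintype ι] (f : ι → R) :
    ∃ d, IsGCDOfFamily f d := by
  obtain ⟨g, t, hg, hgt⟩ := exists_dvd_and_eq_sum f
  exact ⟨g, hg, fun e he => hgt ▸ Finset.dvd_sum fun i _ => (he i).mul_left _⟩

/-- The entrywise form of stable range 1.5, without the coprimality assumption. -/
theorem HasStableRangeOneAndHalf.exists_dvd {R : Type*} [CommRing R] [IsDomain R] [IsBezout R]
    (h : HasStableRangeOneAndHalf R) (a b c : R) (hc : c ≠ 0) :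
    ∃ r, ∀ e, e ∣ a + b * r → e ∣ c → e ∣ a ∧ e ∣ b := by
  obtain ⟨d, t, hd, hdt⟩ := exists_dvd_and_eq_sum ![a, b, c]
  obtain ⟨a', rfl⟩ : d ∣ a := hd 0
  obtain ⟨b', rfl⟩ : d ∣ b := hd 1
  obtain ⟨c', rfl⟩ : d ∣ c := hd 2
  have hd0 : d ≠ 0 := left_ne_zero_of_mul hc
  have hone : t 0 * a' + t 1 * b' + t 2 * c' = 1 := by
    apply mul_left_cancel₀ hd0
    simp only [Fin.sum_univ_three, Matrix.cons_val_zero, Matrix.cons_val_one,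
      Matrix.cons_val] at hdt
    linear_combination -hdt
  have htop : Ideal.span {a', b', c'} = ⊤ := by
    rw [Ideal.eq_top_iff_one, Ideal.mem_span_insert]
    refine ⟨t 0, t 1 * b' + t 2 * c', Ideal.mem_span_pair.2 ⟨_, _, rfl⟩, ?_⟩
    rw [← hone, add_assoc]
  obtain ⟨r, hr⟩ := h a' b' c' (right_ne_zero_of_mul hc) htop
  obtain ⟨x, y, hxy⟩ := Ideal.mem_span_pair.1 ((Ideal.eq_top_iff_one _).1 hr)
  refine ⟨r, fun e he1 he2 => ?_⟩
  have hed : e ∣ d := by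
    have : d = x * (d * a' + d * b' * r) + y * (d * c') := by linear_combination -d * hxy
    rw [this]
    exact dvd_add (he1.mul_left _) (he2.mul_left _)
  exact ⟨hed.mul_right _, hed.mul_right _⟩

/-- Two vectors which are not proportional can be combined without losing common divisors. -/
theorem HasStableRangeOneAndHalf.exists_add_smul_dvd {R ι : Type*} [CommRing R] [IsDomain R]
    [IsBezout R] [Fintype ι] (h : HasStableRangeOneAndHalf R) (x y : ι → R)
    (hxy : ∃ i j, x i * y j ≠ x j * y i) :
    ∃ r : R, ∀ e, (∀ i, e ∣ (x + r • y) i) → (∀ i, e ∣ x i) ∧ ∀ i, e ∣ y i := by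
  obtain ⟨β, t, hβ, hβt⟩ := exists_dvd_and_eq_sum y
  choose y' hy' using hβ
  have hβ0 : β ≠ 0 := by
    rintro rfl
    obtain ⟨i, j, hij⟩ := hxy
    simp [hy'] at hij
  have ht : ∑ i, t i * y' i = 1 := by
    apply mul_left_cancel₀ hβ0
    rw [mul_one, Finset.mul_sum]
    conv_rhs => rw [hβt]
    exact Finset.sum_congr rfl fun i _ => by rw [hy' i]; ring
  set α := ∑ i, t i * x i with hα
  obtain ⟨γ, s, hγ, hγs⟩ := exists_dvd_and_eq_sum fun i => x i - α * y' i
  have hγ0 : γ ≠ 0 := by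
    rintro rfl
    obtain ⟨i, j, hij⟩ := hxy
    have hx : ∀ i, x i = α * y' i := fun i => sub_eq_zero.1 (zero_dvd_iff.1 (hγ i))
    apply hij
    rw [hx i, hx j, hy' i, hy' j]
    ring
  obtain ⟨r, hr⟩ := h.exists_dvd α β γ hγ0
  refine ⟨r, fun e he => ?_⟩
  have hsum : ∑ i, t i * (x + r • y) i = α + β * r := by
    simp only [Pi.add_apply, Pi.smul_apply, smul_eq_mul, mul_add, Finset.sum_add_distrib]
    rw [← hα, hβt, Finset.sum_mul]
    exact congrArg _ (Finset.sum_congr rfl fun i _ => by ring)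
  have h1 : e ∣ α + β * r := hsum ▸ Finset.dvd_sum fun i _ => (he i).mul_left _
  have h2 : e ∣ γ := by
    rw [hγs]
    refine Finset.dvd_sum fun i _ => Dvd.dvd.mul_left ?_ _
    have : x i - α * y' i = (x + r • y) i - (α + β * r) * y' i := by
      simp only [Pi.add_apply, Pi.smul_apply, smul_eq_mul]
      rw [hy' i]
      ring
    rw [this]
    exact dvd_sub (he i) (h1.mul_right _)
  obtain ⟨hea, heb⟩ := hr e h1 h2
  refine ⟨fun i => ?_, fun i => hy' i ▸ heb.mul_right _⟩
  have := dvd_add (h2.trans (hγ i)) (hea.mul_right (y' i))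
  rwa [sub_add_cancel] at this

/-- If all 2 × 2 minors vanish, a nonzero entry times `A` is an outer product, so `A` has rank at
most 1. -/
theorem Matrix.exists_minor_ne_zero_of_one_lt_rank {R m n : Type*} [CommRing R] [IsDomain R]
    [Fintype n] (A : Matrix m n R) (hA : 1 < A.rank) :
    ∃ p q i j, A p i * A q j ≠ A p j * A q i := by
  by_contra! hminor
  obtain ⟨p, i, hpi⟩ : ∃ p i, A p i ≠ 0 := by
    by_contra! h0
    rw [show A = 0 from Matrix.ext h0, Matrix.rank_zero] at hA
    omega
  have hvec : A p i • A = Matrix.vecMulVec (fun q => A q i) (A p) := by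
    ext q j
    rw [Matrix.smul_apply, Matrix.vecMulVec_apply, smul_eq_mul, hminor p q i j, mul_comm]
  have := Matrix.rank_vecMulVec_le (fun q => A q i) (A p)
  rw [← hvec, Matrix.rank_smul_of_mem_nonZeroDivisors _ (mem_nonZeroDivisors_of_ne_zero hpi)] at this
  omega

theorem exists_minor_ne_zero_add_smul {R ι : Type*} [CommRing R] {x y : ι → R}
    (h : ∃ i j, x i * y j ≠ x j * y i) (r : R) :
    ∃ i j, (x + r • y) i * y j ≠ (x + r • y) j * y i := by
  obtain ⟨i, j, hij⟩ := h
  refine ⟨i, j, fun heq => hij ?_⟩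
  simp only [Pi.add_apply, Pi.smul_apply, smul_eq_mul] at heq
  linear_combination heq

open Matrix in
/-- If the row `o` can be modified to a row that is not proportional to some combination of the
other rows, then it absorbs all the other rows. -/
theorem HasStableRangeOneAndHalf.exists_vecMul_dvd {R m n : Type*} [CommRing R] [IsDomain R]
    [IsBezout R] [Fintype m] [Fintype n] [DecidableEq m] (h : HasStableRangeOneAndHalf R)
    (A : Matrix m n R) (o : m) {u₀ w₀ : m → R} (hu₀ : u₀ o = 1) (hw₀ : w₀ o = 0)
    (h₀ : ∃ i j, (u₀ ᵥ* A) i * (w₀ ᵥ* A) j ≠ (u₀ ᵥ* A) j * (w₀ ᵥ* A) i) (S : Finset m) :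
    ∃ u w : m → R, u o = 1 ∧ w o = 0 ∧
      (∃ i j, (u ᵥ* A) i * (w ᵥ* A) j ≠ (u ᵥ* A) j * (w ᵥ* A) i) ∧
      ∀ e, (∀ j, e ∣ (u ᵥ* A) j) → (∀ j, e ∣ (w ᵥ* A) j) ∧ ∀ k ∈ S, k ≠ o → ∀ j, e ∣ A k j := by
  induction S using Finset.induction_on with
  | empty =>
    obtain ⟨r, hr⟩ := h.exists_add_smul_dvd _ _ h₀
    have hvec : (u₀ + r • w₀) ᵥ* A = u₀ ᵥ* A + r • (w₀ ᵥ* A) := by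
      rw [add_vecMul, smul_vecMul]
    refine ⟨u₀ + r • w₀, w₀, by simp [hu₀, hw₀], hw₀, ?_, fun e he => ?_⟩
    · rw [hvec]
      exact exists_minor_ne_zero_add_smul h₀ r
    · rw [hvec] at he
      exact ⟨(hr e he).2, by simp⟩
  | insert k S _ ih =>
    obtain ⟨u, w, hu, hw, hne, hdvd⟩ := ih
    obtain rfl | hko := eq_or_ne k o
    · refine ⟨u, w, hu, hw, hne, fun e he => ⟨(hdvd e he).1, fun l hl hlk => ?_⟩⟩
      exact (hdvd e he).2 l ((Finset.mem_insert.1 hl).resolve_left hlk) hlk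
    -- Row `k` alone may be proportional to `uA`; adding `wA` then repairs this. The correction is
    -- harmless, since common divisors of `uA` already divide `wA`.
    obtain ⟨c, hc⟩ : ∃ c : R, ∃ i j, (u ᵥ* A) i * ((Pi.single k 1 + c • w) ᵥ* A) j ≠
        (u ᵥ* A) j * ((Pi.single k 1 + c • w) ᵥ* A) i := by
      by_contra! hcon
      obtain ⟨i, j, hij⟩ := hne
      have h0 := hcon 0 i j
      have h1 := hcon 1 i j
      simp only [add_vecMul, smul_vecMul, Pi.add_apply, Pi.smul_apply, smul_eq_mul] at h0 h1
      exact hij (by linear_combination h1 - h0)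
    obtain ⟨r, hr⟩ := h.exists_add_smul_dvd _ _ hc
    have hvec : (u + r • (Pi.single k 1 + c • w)) ᵥ* A =
        u ᵥ* A + r • ((Pi.single k 1 + c • w) ᵥ* A) := by
      rw [add_vecMul, smul_vecMul]
    refine ⟨u + r • (Pi.single k 1 + c • w), Pi.single k 1 + c • w, ?_, ?_, ?_, fun e he => ?_⟩
    · simp [hu, hw, hko.symm]
    · simp [hw, hko.symm]
    · rw [hvec]
      exact exists_minor_ne_zero_add_smul hc r
    · rw [hvec] at he
      obtain ⟨heu, hek⟩ := hr e he
      obtain ⟨hew, heS⟩ := hdvd e heu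
      refine ⟨hek, fun l hl hlo j => ?_⟩
      obtain rfl | hl := Finset.mem_insert.1 hl
      · have hj := hek j
        rw [add_vecMul, smul_vecMul, Pi.add_apply, Pi.smul_apply, smul_eq_mul,
          single_one_vecMul] at hj
        exact (dvd_add_left ((hew j).mul_left c)).1 hj
      · exact heS l hl hlo j

open Matrix in
theorem HasStableRangeOneAndHalf.exists_vecMul_dvd_of_one_lt_rank {R m n : Type*} [CommRing R]
    [IsDomain R] [IsBezout R] [Fintype m] [Fintype n] [DecidableEq m]
    (h : HasStableRangeOneAndHalf R) (A : Matrix m n R) (o : m) (hA : 1 < A.rank) :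
    ∃ u : m → R, u o = 1 ∧ ∀ e, (∀ j, e ∣ (u ᵥ* A) j) → ∀ k j, e ∣ A k j := by
  obtain ⟨p, q, hqo, i, j, hij⟩ : ∃ p q, q ≠ o ∧ ∃ i j, A p i * A q j ≠ A p j * A q i := by
    obtain ⟨p, q, i, j, hij⟩ := A.exists_minor_ne_zero_of_one_lt_rank hA
    obtain rfl | hqo := eq_or_ne q o
    · refine ⟨q, p, ?_, i, j, fun heq => hij (by linear_combination -heq)⟩
      rintro rfl
      exact hij (mul_comm _ _)
    · exact ⟨p, q, hqo, i, j, hij⟩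
  obtain ⟨u₀, hu₀, h₀⟩ : ∃ u₀ : m → R, u₀ o = 1 ∧
      (u₀ ᵥ* A) i * A q j ≠ (u₀ ᵥ* A) j * A q i := by
    by_contra! hcon
    -- If row `o` is proportional to row `q`, adding row `p` breaks the proportionality.
    have ho := hcon (Pi.single o 1) (by simp)
    simp only [single_one_vecMul] at ho
    obtain rfl | hpo := eq_or_ne p o
    · exact hij ho
    · have hp := hcon (Pi.single o 1 + Pi.single p 1) (by simp [hpo.symm])
      simp only [add_vecMul, single_one_vecMul, Pi.add_apply, row_apply] at hp ho
      exact hij (by linear_combination hp - ho)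
  obtain ⟨u, w, hu, -, -, hdvd⟩ := h.exists_vecMul_dvd A o (w₀ := Pi.single q 1) hu₀
    (by simp [hqo.symm]) ⟨i, j, by simpa only [single_one_vecMul, row_apply] using h₀⟩ Finset.univ
  refine ⟨u, hu, fun e he => ?_⟩
  have hother := fun k hk => (hdvd e he).2 k (Finset.mem_univ k) hk
  intro k j
  obtain rfl | hk := eq_or_ne k o
  · have hj := he j
    -- As `u o = 1`, row `o` is `uA` minus multiples of the other rows.
    rw [vecMul, dotProduct, ← Finset.add_sum_erase _ _ (Finset.mem_univ k), hu, one_mul] at hj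
    refine (dvd_add_left (Finset.dvd_sum fun l hl => ?_)).1 hj
    exact (hother l (Finset.ne_of_mem_erase hl) j).mul_left _
  · exact hother k hk j

theorem theorem1 (R : Type*) [CommRing R] [IsDomain R] [IsBezout R] :
    HasStableRangeOneAndHalf R ↔
      ∀ (n m : ℕ) (hn : 0 < n) (A : Matrix (Fin n) (Fin m) R), 1 < A.rank →
        ∃ u : Fin n → R, u ⟨0, hn⟩ = 1 ∧
          ∃ d : R, IsGCDOfFamily (fun j : Fin m => Matrix.vecMul u A j) d ∧
            IsGCDOfFamily (fun p : Fin n × Fin m => A p.1 p.2) d := by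
  constructor
  · intro h n m hn A hA
    obtain ⟨u, hu, hdvd⟩ := h.exists_vecMul_dvd_of_one_lt_rank A ⟨0, hn⟩ hA
    obtain ⟨d, hd⟩ := exists_isGCDOfFamily fun j => Matrix.vecMul u A j
    refine ⟨u, hu, d, hd, fun p => hdvd d hd.1 p.1 p.2, fun e he => hd.2 e fun j => ?_⟩
    change e ∣ ∑ k, u k * A k j
    exact Finset.dvd_sum fun k _ => (he (k, j)).mul_left _
  · intro h a b c hc habc
    obtain rfl | hb := eq_or_ne b 0
    · refine ⟨0, ?_⟩
      rw [zero_mul, add_zero, ← habc, Set.insert_comm, Ideal.span_insert_zero]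
    -- For `u = [1, r]` this matrix gives `uA = [a + b r, c]`; its determinant is `-bc ≠ 0`.
    have hrank : 1 < (!![a, c; b, 0]).rank := by
      rw [Matrix.rank_of_det_ne_zero]
      · simp
      · simp [Matrix.det_fin_two, hb, hc]
    obtain ⟨u, hu, d, hd, hdA⟩ := h 2 2 two_pos !![a, c; b, 0] hrank
    have hu0 : u 0 = 1 := hu
    refine ⟨u 1, ?_⟩
    obtain ⟨g, hg⟩ := (IsBezout.span_pair_isPrincipal (a + b * u 1) c).principal
    have hgd : g ∣ d := by
      have hmem : ∀ x ∈ Ideal.span {a + b * u 1, c}, g ∣ x := fun x hx => by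
        rw [hg] at hx
        exact Ideal.mem_span_singleton.1 hx
      refine hd.2 g fun j => ?_
      fin_cases j
      · simpa [Matrix.vecMul, dotProduct, Fin.sum_univ_two, hu0, mul_comm] using
          hmem _ (Ideal.subset_span (Set.mem_insert _ _))
      · simpa [Matrix.vecMul, dotProduct, Fin.sum_univ_two, hu0] using
          hmem _ (Ideal.subset_span (Set.mem_insert_of_mem _ rfl))
    have hd1 : d ∣ 1 := by
      rw [← Ideal.mem_span_singleton]
      refine (Ideal.span_le.2 ?_ : Ideal.span {a, b, c} ≤ _) ((Ideal.eq_top_iff_one _).1 habc)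
      rintro x (rfl | rfl | rfl) <;> refine Ideal.mem_span_singleton.2 ?_
      · exact hdA.1 (0, 0)
      · exact hdA.1 (1, 0)
      · exact hdA.1 (0, 1)
    rw [hg]
    exact Ideal.span_singleton_eq_top.2 (isUnit_of_dvd_one (hgd.trans hd1))
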